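/- Let $n,s,d$ be integers with $0\le s\le n$ and $d\ge 2$. Let $q_0=n+1$, let $q_1<q_2<\cdots$ be the prime numbers greater than $n+1$ in increasing order, and let $a_{ij}=\frac{1}{q_i-j}$ for $i\ge 0$, $0\le j\le n$ (a Cauchy matrix). Let $T_d$ be the Chebyshev polynomial (of the first kind) of degree $d$, and put $$\tilde g(x)=\sum_{j=1}^n a_{0j}T_d(x_j),\qquad \tilde f_i(x)=a_{i0}+\sum_{j=1}^n a_{ij}\bigl(T_d(x_j)+1\bigr)\quad(1\le i\le s),$$ $$\tilde g_j(x,\lambda)=\lambda_0\frac{\partial\tilde g}{\partial x_j}-\sum_{i=1}^s\lambda_i\frac{\partial\tilde f_i}{\partial x_j}\quad(1\le j\le n).$$ Let $W\subset\mathbb A^n\times\mathbb P^s$ (over $\mathbb C$, with homogeneous coordinates $\lambda_0,\dots,\lambda_s$ on $\mathbb P^s$) be the set of common zeros of $\tilde f_1,\dots,\tilde f_s,\tilde g_1,\dots,\tilde g_n$. Then: 1. $W\subset\mathbb A^n\times\{\lambda_0\ne 0\}$, and $W$ is zero-dimensional: it is finite, with exactly $D_s=\binom ns d^s(d-1)^{n-s}\geq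 1$ points. 2. Distinct points of $W$ have distinct projections to $\mathbb A^n$. 3. At each point of $W$, in the affine coordinates $(x_1,\dots,x_n,\lambda_1,\dots,\lambda_s)$ with $\lambda_0=1$, the Jacobian determinant, with respect to $x_1,\dots,x_n,\lambda_1,\dots,\lambda_s$, of $\tilde f_1,\dots,\tilde f_s$ and of the polynomials obtained from $\tilde g_1,\dots,\tilde g_n$ by setting $\lambda_0=1$ is nonzero. -/

import Mathlib

namespace StartSystem

open MvPolynomial

noncomputable section

/-- `q n 0 = n + 1`, and `q n 1 < q n 2 < ⋯` are the prime numbers greater than `n + 1`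
in increasing order. -/
def q (n : ℕ) : ℕ → ℕ
  | 0 => n + 1
  | i + 1 => Nat.nth (fun p => p.Prime ∧ n + 1 < p) i

/-- The entries of the Cauchy matrix, `a i j = 1 / (q_i - j)` for `0 ≤ j ≤ n`. -/
def a (n i j : ℕ) : ℚ := 1 / ((q n i : ℚ) - (j : ℚ))

/-- The Chebyshev polynomial (of the first kind) of degree `d` in the variable `x_j`. The index
`j : Fin n` stands for the variable number `j + 1`. -/
def chebyshevX (n d : ℕ) (j : Fin n) : MvPolynomial (Fin n) ℚ :=
  Polynomial.aeval (X j) (Polynomial.Chebyshev.T ℚ (d : ℤ))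

/-- `g̃ = ∑_{1 ≤ j ≤ n} a_{0j} T_d(x_j)`. -/
def gTilde (n d : ℕ) : MvPolynomial (Fin n) ℚ :=
  ∑ j : Fin n, C (a n 0 (j + 1)) * chebyshevX n d j

/-- `f̃_i = a_{i0} + ∑_{1 ≤ j ≤ n} a_{ij} (T_d(x_j) + 1)`, for `i ≥ 1`. -/
def fTilde (n d i : ℕ) : MvPolynomial (Fin n) ℚ :=
  C (a n i 0) + ∑ j : Fin n, C (a n i (j + 1)) * (chebyshevX n d j + 1)

/-- `g̃_j = λ_0 ∂g̃/∂x_j - ∑_{1 ≤ i ≤ s} λ_i ∂f̃_i/∂x_j`, a polynomial in `x_1, …, x_n` (variables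
`Sum.inl _`) and `λ_0, …, λ_s` (variables `Sum.inr _`). -/
def gTildeJ (n d s : ℕ) (j : Fin n) : MvPolynomial (Fin n ⊕ Fin (s + 1)) ℚ :=
  X (Sum.inr 0) * rename Sum.inl (pderiv j (gTilde n d)) -
    ∑ i : Fin s, X (Sum.inr i.succ) * rename Sum.inl (pderiv j (fTilde n d (i + 1)))

/-- The common zeros of `f̃_1, …, f̃_s, g̃_1, …, g̃_n` in `𝔸ⁿ × ℙˢ` over `ℂ`. The `g̃_j` are
homogeneous in `λ`, so the choice of homogeneous coordinates is irrelevant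
(see `mk_mem_startVariety`). -/
def startVariety (n d s : ℕ) :
    Set ((Fin n → ℂ) × Projectivization ℂ (Fin (s + 1) → ℂ)) :=
  {w | (∀ i : Fin s, aeval w.1 (fTilde n d (i + 1)) = 0) ∧
    ∀ j : Fin n, aeval (Sum.elim w.1 w.2.rep) (gTildeJ n d s j) = 0}

/-- The open subset `{λ_0 ≠ 0}` of `ℙˢ`. -/
def chart (s : ℕ) : Set (Projectivization ℂ (Fin (s + 1) → ℂ)) :=
  {L | L.rep 0 ≠ 0}

/-- The coordinates `(λ_1 / λ_0, …, λ_s / λ_0)` of a point of `{λ_0 ≠ 0} ⊆ ℙˢ`. -/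
def affineCoord {s : ℕ} (L : Projectivization ℂ (Fin (s + 1) → ℂ)) : Fin s → ℂ :=
  fun i => L.rep i.succ / L.rep 0

/-- Dehomogenization `λ_0 = 1`. -/
def dehomogenize {n s : ℕ} (p : MvPolynomial (Fin n ⊕ Fin (s + 1)) ℚ) :
    MvPolynomial (Fin n ⊕ Fin s) ℚ :=
  aeval (Sum.elim (fun j => X (Sum.inl j)) (Fin.cons 1 fun i => X (Sum.inr i)) :
    Fin n ⊕ Fin (s + 1) → MvPolynomial (Fin n ⊕ Fin s) ℚ) p

/-- The `n + s` polynomials `g̃_1, …, g̃_n` (with `λ_0 = 1`) and `f̃_1, …, f̃_s` in the `n + s`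
variables `x_1, …, x_n, λ_1, …, λ_s`. -/
def affineSystem (n d s : ℕ) : Fin n ⊕ Fin s → MvPolynomial (Fin n ⊕ Fin s) ℚ :=
  Sum.elim (fun j => dehomogenize (gTildeJ n d s j))
    (fun i => rename Sum.inl (fTilde n d (i + 1)))

/-- The Jacobian determinant of the dehomogenized system with respect to
`x_1, …, x_n, λ_1, …, λ_s` (the order of the polynomials affects it only by a sign). -/
def jacobianDet (n d s : ℕ) : MvPolynomial (Fin n ⊕ Fin s) ℚ :=
  (Matrix.of fun r c : Fin n ⊕ Fin s => pderiv c (affineSystem n d s r)).det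

theorem aeval_gTildeJ (n d s : ℕ) (j : Fin n) (x : Fin n → ℂ) (v : Fin (s + 1) → ℂ) :
    aeval (Sum.elim x v) (gTildeJ n d s j) =
      v 0 * aeval x (pderiv j (gTilde n d)) -
        ∑ i : Fin s, v i.succ * aeval x (pderiv j (fTilde n d (i + 1))) := by
  simp [gTildeJ, aeval_rename, Sum.elim_comp_inl]

/-- Membership in `startVariety` may be tested on any homogeneous coordinates. -/
theorem mk_mem_startVariety (n d s : ℕ) (x : Fin n → ℂ) (v : Fin (s + 1) → ℂ) (hv : v ≠ 0) :
    (x, Projectivization.mk ℂ v hv) ∈ startVariety n d s ↔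
      (∀ i : Fin s, aeval x (fTilde n d (i + 1)) = 0) ∧
        ∀ j : Fin n, aeval (Sum.elim x v) (gTildeJ n d s j) = 0 := by
  obtain ⟨c, hc⟩ := Projectivization.exists_smul_eq_mk_rep ℂ v hv
  have h : ∀ j : Fin n, aeval (Sum.elim x (Projectivization.mk ℂ v hv).rep) (gTildeJ n d s j) =
      (c : ℂ) * aeval (Sum.elim x v) (gTildeJ n d s j) := by
    intro j
    rw [aeval_gTildeJ, aeval_gTildeJ, ← hc, mul_sub, Finset.mul_sum]
    simp [Units.smul_def, mul_assoc]
  simp [startVariety, h]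

end

end StartSystem

/-!
Since `g̃` and the `f̃_i` are affine in the `T_d(x_j)`, the polynomial `g̃_j` is `T_d'(x_j)` times a
linear form in `λ`. Call `j` noncritical when `T_d'(x_j) ≠ 0`; at the other coordinates
`T_d(x_j) = ±1`, so that `T_d(x_j) + 1` is an integer.

On `W` exactly `s` coordinates are noncritical. There are at most `s`, because a nonzero `λ` cannot
annihilate `s + 1` columns of a Cauchy matrix. If there were only `t < s`, the explicit linear
relation among the rows `1, …, t + 1` of the `t` noncritical columns would eliminate the noncritical
coordinates from `f̃_1 = ⋯ = f̃_{t+1} = 0` and leave a vanishing sum of rational numbers. For the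
prime `p = q_{t+1}` the coefficients of the relation are `p`-adic units, and every term of the sum
is `p`-integral except the one coming from `a_{t+1,0} = 1 / p`, a contradiction.

Conversely, fix `s` noncritical indices and a root of `T_d'` at each of the remaining ones. The
linear system `f̃_i = 0` has a unique solution in the noncritical `T_d(x_j)`, none of which is `±1`,
again by the `p`-adic argument, so each has `d` preimages, and `λ` is unique up to scaling. This
gives `(d - 1)^(n - s) * d^s` points for each choice of indices. The Jacobian at such a point is a
diagonal matrix bordered by two Cauchy blocks with the `j`-th row or column scaled by `T_d'(x_j)`.
Its `j`-th diagonal entry vanishes exactly at the noncritical `j`, the scaling factor exactly at the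
other ones, so invertibility reduces to that of an `s × s` Cauchy matrix.
-/

namespace StartSystem

open MvPolynomial

noncomputable section

section PartialFractions

variable {K κ : Type*} [Field K] [DecidableEq κ] {J : Finset κ} {y : κ → K} {c : κ → K}

/-- The numerator of the partial fraction sum `∑ j ∈ J, c j / (X - y j)` over the common
denominator `Lagrange.nodal J y`, encoded as the polynomial of degree less than `#J` with value
`c j * ∏ k ∈ J.erase j, (y j - y k)` at the node `y j`. -/
def partialFractionNumerator (J : Finset κ) (y c : κ → K) : Polynomial K :=
  Lagrange.interpolate J y fun j => c j / Lagrange.nodalWeight J y j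

theorem degree_partialFractionNumerator_lt (hy : Set.InjOn y J) :
    (partialFractionNumerator J y c).degree < J.card :=
  Lagrange.degree_interpolate_lt _ hy

theorem eval_partialFractionNumerator (hy : Set.InjOn y J) {z : K} (hz : ∀ j ∈ J, z ≠ y j) :
    (partialFractionNumerator J y c).eval z =
      (Lagrange.nodal J y).eval z * ∑ j ∈ J, c j / (z - y j) := by
  rw [partialFractionNumerator, Lagrange.eval_interpolate_not_at_node _ hz]
  congr 1
  refine Finset.sum_congr rfl fun j hj => ?_
  have := Lagrange.nodalWeight_ne_zero hy hj
  field_simp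

theorem eq_zero_of_partialFractionNumerator_eq_zero (hy : Set.InjOn y J)
    (h : partialFractionNumerator J y c = 0) {j : κ} (hj : j ∈ J) : c j = 0 := by
  have hval : (partialFractionNumerator J y c).eval (y j) = c j / Lagrange.nodalWeight J y j :=
    Lagrange.eval_interpolate_at_node _ hy hj
  rw [h, Polynomial.eval_zero, eq_comm, div_eq_zero_iff] at hval
  exact hval.resolve_right (Lagrange.nodalWeight_ne_zero hy hj)

end PartialFractions

section Cauchy

variable {K ι κ : Type*} [Field K] {I : Finset ι} {J : Finset κ} {x : ι → K} {y : κ → K}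
  {c : κ → K}

theorem eq_zero_of_sum_div_sub_eq_zero (hx : Set.InjOn x I) (hy : Set.InjOn y J)
    (hxy : ∀ i ∈ I, ∀ j ∈ J, x i ≠ y j) (hcard : J.card ≤ I.card)
    (h : ∀ i ∈ I, ∑ j ∈ J, c j / (x i - y j) = 0) : ∀ j ∈ J, c j = 0 := by
  classical
  have hnum : partialFractionNumerator J y c = 0 := by
    refine Polynomial.eq_zero_of_degree_lt_of_eval_index_eq_zero (v := x) (s := I) hx
      ((degree_partialFractionNumerator_lt hy).trans_le (by exact_mod_cast hcard)) fun i hi => ?_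
    rw [eval_partialFractionNumerator hy (hxy i hi), h i hi, mul_zero]
  exact fun j => eq_zero_of_partialFractionNumerator_eq_zero hy hnum

/-- The sum is the divided difference at the nodes `x i` of a polynomial of degree less than
`#I - 1`. -/
theorem sum_nodalWeight_mul_sum_div_sub_eq_zero [DecidableEq ι] (hx : Set.InjOn x I)
    (hy : Set.InjOn y J) (hxy : ∀ i ∈ I, ∀ j ∈ J, x i ≠ y j) (hcard : J.card < I.card) :
    ∑ i ∈ I, Lagrange.nodalWeight I x i * (Lagrange.nodal J y).eval (x i) *
      ∑ j ∈ J, c j / (x i - y j) = 0 := by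
  classical
  have hdeg : (partialFractionNumerator J y c).degree < J.card :=
    degree_partialFractionNumerator_lt hy
  have hcoeff : (partialFractionNumerator J y c).coeff (I.card - 1) = 0 :=
    Polynomial.coeff_eq_zero_of_degree_lt
      (hdeg.trans_le (by exact_mod_cast Nat.le_sub_one_of_lt hcard))
  rw [← hcoeff, Lagrange.coeff_eq_sum hx (hdeg.trans (by exact_mod_cast hcard))]
  refine Finset.sum_congr rfl fun i hi => ?_
  rw [eval_partialFractionNumerator hy (hxy i hi), Lagrange.nodalWeight, Finset.prod_inv_distrib,
    mul_assoc, div_eq_inv_mul]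

end Cauchy

section PadicNorm

variable {p : ℕ} [Fact p.Prime]

theorem padicNorm_natCast_sub_natCast_eq_one {u v : ℕ} (huv : u ≠ v) (hu : u < p + v)
    (hv : v < p + u) : padicNorm p ((u : ℚ) - v) = 1 := by
  have hsub : ((u : ℚ) - v) = ((u - v : ℤ) : ℚ) := by push_cast; rfl
  rw [hsub, padicNorm.int_eq_one_iff]
  intro hdvd
  have := Int.eq_zero_of_abs_lt_dvd hdvd (abs_lt.mpr ⟨by omega, by omega⟩)
  omega

theorem sum_ne_zero_of_one_lt_padicNorm {ι : Type*} {s : Finset ι} {f : ι → ℚ}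
    {i : ι} (hi : i ∈ s) (hfi : 1 < padicNorm p (f i))
    (hf : ∀ k ∈ s, k ≠ i → padicNorm p (f k) ≤ 1) : ∑ k ∈ s, f k ≠ 0 := by
  classical
  intro hsum
  rw [← Finset.add_sum_erase s f hi, add_eq_zero_iff_eq_neg] at hsum
  rw [hsum, padicNorm.neg] at hfi
  refine hfi.not_ge (padicNorm.sum_le' (fun k hk => ?_) zero_le_one)
  exact hf k (Finset.mem_of_mem_erase hk) (Finset.ne_of_mem_erase hk)

end PadicNorm

section StartMatrix

theorem infinite_primes_gt (n : ℕ) :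
    (Set.ofPred fun p : ℕ => p.Prime ∧ n + 1 < p).Infinite := by
  refine Set.infinite_of_not_bddAbove fun ⟨m, hm⟩ => ?_
  obtain ⟨p, hp, hprime⟩ := Nat.exists_infinite_primes (m + n + 2)
  have := hm (show p.Prime ∧ n + 1 < p from ⟨hprime, by omega⟩)
  omega

theorem prime_q_succ (n i : ℕ) : (q n (i + 1)).Prime :=
  (Nat.nth_mem_of_infinite (infinite_primes_gt n) i).1

theorem q_strictMono (n : ℕ) : StrictMono (q n) := by
  refine strictMono_nat_of_lt_succ fun i => ?_
  cases i with
  | zero => exact (Nat.nth_mem_of_infinite (infinite_primes_gt n) 0).2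
  | succ i => exact Nat.nth_strictMono (infinite_primes_gt n) i.lt_succ_self

theorem lt_q (n i : ℕ) : n < q n i :=
  Nat.lt_of_succ_le ((q_strictMono n).monotone i.zero_le)

variable {K : Type*} [Field K] [CharZero K] {n : ℕ}

theorem ratCast_a (n i j : ℕ) : (a n i j : K) = 1 / ((q n i : K) - j) := by
  simp [a]

theorem injective_natCast_q (n : ℕ) : Function.Injective fun i => (q n i : K) :=
  Nat.cast_injective.comp (q_strictMono n).injective

theorem injective_natCast_fin_succ (n : ℕ) : Function.Injective fun j : Fin n => (j : K) + 1 :=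
  fun _ _ hjk => Fin.ext (Nat.cast_injective (add_right_cancel hjk))

theorem natCast_q_ne_fin_succ (i : ℕ) (j : Fin n) : (q n i : K) ≠ (j : K) + 1 := by
  have := lt_q n i
  exact_mod_cast (show q n i ≠ j + 1 by omega)

theorem ratCast_a_mul (i : ℕ) (j : Fin n) (c : K) :
    (a n i (j + 1) : K) * c = c / ((q n i : K) - ((j : K) + 1)) := by
  rw [ratCast_a, Nat.cast_succ, one_div_mul_eq_div]

theorem eq_zero_of_sum_columns_eq_zero {ι : Type*} [Fintype ι] {r : ι → ℕ}
    (hr : Function.Injective r) {J : Finset (Fin n)} (hcard : J.card ≤ Fintype.card ι)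
    {c : Fin n → K} (h : ∀ i, ∑ j ∈ J, (a n (r i) (j + 1) : K) * c j = 0) : ∀ j ∈ J, c j = 0 := by
  simp only [ratCast_a_mul] at h
  exact eq_zero_of_sum_div_sub_eq_zero (I := Finset.univ) ((injective_natCast_q n).comp hr).injOn
    (injective_natCast_fin_succ n).injOn (fun i _ j _ => natCast_q_ne_fin_succ (r i) j) hcard
    fun i _ => h i

theorem eq_zero_of_sum_rows_eq_zero {ι : Type*} [Fintype ι] {r : ι → ℕ}
    (hr : Function.Injective r) {J : Finset (Fin n)} (hcard : Fintype.card ι ≤ J.card)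
    {c : ι → K} (h : ∀ j ∈ J, ∑ i, (a n (r i) (j + 1) : K) * c i = 0) : c = 0 := by
  classical
  refine funext fun i => eq_zero_of_sum_div_sub_eq_zero (J := Finset.univ)
    (injective_natCast_fin_succ n).injOn ((injective_natCast_q (K := K) n).comp hr).injOn
    (fun j _ i _ => (natCast_q_ne_fin_succ (r i) j).symm) hcard
    (fun j hj => neg_eq_zero.mp ?_) i (Finset.mem_univ i)
  rw [← h j hj, ← Finset.sum_neg_distrib]
  refine Finset.sum_congr rfl fun i _ => ?_
  rw [ratCast_a_mul, ← div_neg, Function.comp_apply, neg_sub]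

/-- Coefficients of a linear relation between the rows `i ∈ I` of the Cauchy matrix restricted to
the columns `j ∈ J`, valid when `#J < #I`. -/
def rowRelation (n : ℕ) (I : Finset ℕ) (J : Finset (Fin n)) (i : ℕ) : ℚ :=
  Lagrange.nodalWeight I (fun k => (q n k : ℚ)) i *
    (Lagrange.nodal J fun j : Fin n => (j : ℚ) + 1).eval (q n i : ℚ)

theorem sum_rowRelation_mul_eq_zero {I : Finset ℕ} {J : Finset (Fin n)} (hcard : J.card < I.card)
    (c : Fin n → K) :
    ∑ i ∈ I, (rowRelation n I J i : K) * ∑ j ∈ J, (a n i (j + 1) : K) * c j = 0 := by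
  have h := sum_nodalWeight_mul_sum_div_sub_eq_zero (c := c)
    (injective_natCast_q (K := K) n).injOn (injective_natCast_fin_succ n).injOn
    (fun i _ j _ => natCast_q_ne_fin_succ i j) hcard
  simpa [rowRelation, ratCast_a_mul, Lagrange.nodalWeight, Lagrange.eval_nodal] using h

theorem padicNorm_rowRelation_eq_one {p m : ℕ} [Fact p.Prime] (hp : q n m = p) {I : Finset ℕ}
    (hI : ∀ i ∈ I, i ≤ m) (J : Finset (Fin n)) {i : ℕ} (hi : i ∈ I) :
    padicNorm p (rowRelation n I J i) = 1 := by
  have hle : ∀ k ∈ I, n < q n k ∧ q n k ≤ p := fun k hk =>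
    ⟨lt_q n k, hp ▸ (q_strictMono n).monotone (hI k hk)⟩
  have hi' := hle i hi
  simp only [rowRelation, Lagrange.nodalWeight, Lagrange.eval_nodal, padicNorm.mul,
    IsAbsoluteValue.map_prod (padicNorm p)]
  rw [Finset.prod_eq_one, Finset.prod_eq_one, mul_one]
  · intro j _
    rw [← Nat.cast_succ]
    exact padicNorm_natCast_sub_natCast_eq_one (by omega) (by omega) (by omega)
  · intro k hk
    have hk' := hle k (Finset.mem_of_mem_erase hk)
    have hik := (q_strictMono n).injective.ne (Finset.ne_of_mem_erase hk).symm
    rw [inv_eq_one_div, padicNorm.div, padicNorm.one,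
      padicNorm_natCast_sub_natCast_eq_one hik (by omega) (by omega), div_one]

theorem padicNorm_a_eq_one {p i j : ℕ} [Fact p.Prime] (hj : j ≤ n) (hij : q n i < p + j) :
    padicNorm p (a n i j) = 1 := by
  have := lt_q n i
  rw [a, padicNorm.div, padicNorm.one,
    padicNorm_natCast_sub_natCast_eq_one (by omega) hij (by omega), div_one]

theorem padicNorm_a_mul_intCast_le_one {p i : ℕ} [Fact p.Prime] (hi : q n i ≤ p) (j : Fin n)
    (m : ℤ) : padicNorm p (a n i (j + 1) * m) ≤ 1 := by
  rw [padicNorm.mul, padicNorm_a_eq_one (by omega) (by omega), one_mul]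
  exact padicNorm.of_int m

/-- The column `j = 0` contributes `1 / p` in the row with `q n i = p`, the only term of the row
relation which is not `p`-integral. -/
theorem sum_rowRelation_mul_ne_zero {m : ℕ} (hm : m ≠ 0) {I : Finset ℕ} (hmI : m ∈ I)
    (hI : ∀ i ∈ I, i ≤ m) (J J' : Finset (Fin n)) (y : Fin n → ℤ) :
    ∑ i ∈ I, rowRelation n I J i * (a n i 0 + ∑ j ∈ J', a n i (j + 1) * y j) ≠ 0 := by
  obtain ⟨m, rfl⟩ := Nat.exists_eq_succ_of_ne_zero hm
  obtain ⟨p, hp⟩ : ∃ p, q n (m + 1) = p := ⟨_, rfl⟩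
  have : Fact p.Prime := ⟨hp ▸ prime_q_succ n m⟩
  have hle : ∀ i ∈ I, q n i ≤ p := fun i hi => hp ▸ (q_strictMono n).monotone (hI i hi)
  have hint : ∀ i ∈ I, padicNorm p (∑ j ∈ J', a n i (j + 1) * y j) ≤ 1 := fun i hi =>
    padicNorm.sum_le' (fun j _ => padicNorm_a_mul_intCast_le_one (hle i hi) j (y j)) zero_le_one
  have hpole : 1 < padicNorm p (a n (m + 1) 0) := by
    rw [a, hp, Nat.cast_zero, sub_zero, padicNorm.div, padicNorm.one,
      padicNorm.padicNorm_p_of_prime, one_div, inv_inv]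
    exact_mod_cast this.out.one_lt
  refine sum_ne_zero_of_one_lt_padicNorm (p := p) hmI ?_ fun i hi him => ?_
  · rw [padicNorm.mul, padicNorm_rowRelation_eq_one hp hI J hmI, one_mul,
      padicNorm.add_eq_max_of_ne ((hint _ hmI).trans_lt hpole).ne']
    exact lt_max_of_lt_left hpole
  · rw [padicNorm.mul, padicNorm_rowRelation_eq_one hp hI J hi, one_mul]
    have hlt : q n i < p := hp ▸ q_strictMono n (lt_of_le_of_ne (hI i hi) him)
    exact padicNorm.nonarchimedean.trans
      (max_le (padicNorm_a_eq_one n.zero_le hlt).le (hint i hi))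

theorem exists_row_ne_zero (J : Finset (Fin n)) {y : Fin n → K}
    (hy : ∀ j ∉ J, y j ∈ Set.range ((↑) : ℤ → K)) :
    ∃ i ∈ Finset.Icc 1 (J.card + 1),
      (a n i 0 : K) + ∑ j : Fin n, (a n i (j + 1) : K) * y j ≠ 0 := by
  choose! z hz using hy
  by_contra! hrows
  set I := Finset.Icc 1 (J.card + 1)
  refine sum_rowRelation_mul_ne_zero J.card.succ_ne_zero
    (Finset.mem_Icc.mpr ⟨by omega, le_rfl⟩ : J.card + 1 ∈ I)
    (fun i hi => (Finset.mem_Icc.mp hi).2) J Jᶜ z (Rat.cast_injective (α := K) ?_)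
  have hrelation := sum_rowRelation_mul_eq_zero (n := n) (I := I) (J := J) (by simp [I]) y
  rw [Rat.cast_zero, ← neg_eq_zero, ← hrelation, Rat.cast_sum, ← Finset.sum_neg_distrib]
  refine Finset.sum_congr rfl fun i hi => ?_
  have hrow := hrows i hi
  rw [← Finset.sum_add_sum_compl J, Finset.sum_congr rfl fun j hj =>
    congrArg _ (hz j (Finset.mem_compl.mp hj)).symm] at hrow
  push_cast
  linear_combination -(rowRelation n I J i : K) * hrow

end StartMatrix

section LinearSystem

open Matrix

variable {K : Type*} [Field K] {n s : ℕ} {J : Finset (Fin n)}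

/-- The linear part `(a_{ij})`, `1 ≤ i ≤ s`, `1 ≤ j ≤ n`, of the equations `f̃_i = 0` in the
variables `T_d(x_j) + 1`. -/
def constraintMatrix (K : Type*) [Field K] (n s : ℕ) : Matrix (Fin s) (Fin n) K :=
  Matrix.of fun i j => (a n (i + 1) (j + 1) : K)

/-- The equations `f̃_i = 0`, `1 ≤ i ≤ s`, as an affine map in the variables
`z_j = T_d(x_j) + 1`. -/
def constraint (n s : ℕ) (z : Fin n → K) : Fin s → K :=
  (fun i : Fin s => (a n (i + 1) 0 : K)) + constraintMatrix K n s *ᵥ z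

/-- The linear form in the multipliers `λ` which is the cofactor of `T_d'(x_j)` in `g̃_j`. -/
def multiplierForm (n s : ℕ) : (Fin (s + 1) → K) →ₗ[K] (Fin n → K) where
  toFun v j := v 0 * a n 0 (j + 1) - (Fin.tail v ᵥ* constraintMatrix K n s) j
  map_add' v w := by
    ext j
    simp only [vecMul, dotProduct, Fin.tail, Pi.add_apply, add_mul, Finset.sum_add_distrib]
    ring
  map_smul' c v := by
    ext j
    simp only [vecMul, dotProduct, Fin.tail, Pi.smul_apply, smul_eq_mul, mul_assoc,
      ← Finset.mul_sum, RingHom.id_apply, mul_sub]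

theorem multiplierForm_apply (v : Fin (s + 1) → K) (j : Fin n) :
    multiplierForm n s v j = v 0 * a n 0 (j + 1) - (Fin.tail v ᵥ* constraintMatrix K n s) j :=
  rfl

theorem exists_multiplierForm_eq_zero (hJ : J.card ≤ s) :
    ∃ v : Fin (s + 1) → K, v ≠ 0 ∧ ∀ j ∈ J, multiplierForm n s v j = 0 := by
  have hker := LinearMap.ker_ne_bot_of_finrank_lt
    (f := LinearMap.funLeft K K ((↑) : J → Fin n) ∘ₗ multiplierForm n s)
    (by simpa using Nat.lt_succ_of_le hJ)
  obtain ⟨v, hv, hv0⟩ := Submodule.exists_mem_ne_zero_of_ne_bot hker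
  exact ⟨v, hv0, fun j hj => congrFun (LinearMap.mem_ker.mp hv) ⟨j, hj⟩⟩

variable [CharZero K]

theorem eq_zero_of_constraintMatrix_mulVec_eq_zero (hJ : J.card ≤ s) {c : Fin n → K}
    (hc : ∀ j ∉ J, c j = 0) (h : constraintMatrix K n s *ᵥ c = 0) : c = 0 := by
  refine funext fun j => by_contra fun hj => hj ?_
  have hjJ : j ∈ J := not_imp_comm.mp (hc j) hj
  refine eq_zero_of_sum_columns_eq_zero (r := fun i : Fin s => (i : ℕ) + 1)
    (fun _ _ h => Fin.ext (Nat.succ_injective h)) (by simpa using hJ) (fun i => ?_) j hjJ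
  rw [Finset.sum_subset J.subset_univ fun k _ hk => by rw [hc k hk, mul_zero]]
  exact congrFun h i

theorem eq_zero_of_vecMul_constraintMatrix_eq_zero (hJ : s ≤ J.card) {l : Fin s → K}
    (h : ∀ j ∈ J, (l ᵥ* constraintMatrix K n s) j = 0) : l = 0 := by
  refine eq_zero_of_sum_rows_eq_zero (r := fun i : Fin s => (i : ℕ) + 1)
    (fun _ _ h => Fin.ext (Nat.succ_injective h)) (by simpa using hJ) fun j hj => ?_
  rw [← h j hj]
  exact Finset.sum_congr rfl fun i _ => mul_comm _ _

theorem eq_zero_of_multiplierForm_eq_zero (hJ : s < J.card) {v : Fin (s + 1) → K}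
    (h : ∀ j ∈ J, multiplierForm n s v j = 0) : v = 0 := by
  have hsigned : (Fin.cons (v 0) (-Fin.tail v) : Fin (s + 1) → K) = 0 := by
    refine eq_zero_of_sum_rows_eq_zero Fin.val_injective (by simpa using hJ) fun j hj => ?_
    rw [Fin.sum_univ_succ, ← h j hj, multiplierForm_apply, sub_eq_add_neg, vecMul, dotProduct,
      ← Finset.sum_neg_distrib]
    simp [mul_comm, constraintMatrix]
  rw [← Fin.cons_self_tail v]
  refine funext <| Fin.cases ?_ fun i => ?_
  · exact congrFun hsigned 0
  · exact neg_eq_zero.mp (congrFun hsigned i.succ)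

theorem eq_zero_of_multiplierForm_eq_zero_of_zero (hJ : s ≤ J.card) {v : Fin (s + 1) → K}
    (h0 : v 0 = 0) (h : ∀ j ∈ J, multiplierForm n s v j = 0) : v = 0 := by
  have htail : Fin.tail v = 0 := eq_zero_of_vecMul_constraintMatrix_eq_zero hJ fun j hj => by
    simpa [multiplierForm_apply, h0] using h j hj
  exact funext <| Fin.cases h0 fun i => congrFun htail i

theorem existsUnique_constraint_eq_zero (hJ : J.card = s) (y : Fin n → K) :
    ∃! z : Fin n → K, (∀ j ∉ J, z j = y j) ∧ constraint n s z = 0 := by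
  let Φ : (Fin n → K) →ₗ[K] ({j // j ∉ J} → K) × (Fin s → K) :=
    (LinearMap.funLeft K K Subtype.val).prod (constraintMatrix K n s).mulVecLin
  have hinj : Function.Injective Φ := by
    refine (injective_iff_map_eq_zero Φ).mpr fun c hc => ?_
    obtain ⟨hcJ, hcM⟩ := Prod.ext_iff.mp hc
    exact eq_zero_of_constraintMatrix_mulVec_eq_zero hJ.le (fun j hj => congrFun hcJ ⟨j, hj⟩) hcM
  have hrank : Module.finrank K (Fin n → K) =
      Module.finrank K (({j // j ∉ J} → K) × (Fin s → K)) := by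
    have := J.card_le_univ
    simp_all [Fintype.card_subtype_compl]
  have hbij : Function.Bijective Φ :=
    ⟨hinj, (LinearMap.injective_iff_surjective_of_finrank_eq_finrank hrank).mp hinj⟩
  let target : ({j // j ∉ J} → K) × (Fin s → K) :=
    (fun j => y j, -fun i : Fin s => (a n (i + 1) 0 : K))
  have hΦ (z : Fin n → K) :
      Φ z = target ↔ (∀ j ∉ J, z j = y j) ∧ constraint n s z = 0 := by
    rw [constraint, add_eq_zero_iff_eq_neg']
    simp [Φ, target, Prod.ext_iff, funext_iff, LinearMap.funLeft]
  exact (existsUnique_congr hΦ).mp (hbij.existsUnique target)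

theorem constraint_ne_zero_of_card_lt (hJ : J.card < s) {y : Fin n → K}
    (hy : ∀ j ∉ J, y j ∈ Set.range ((↑) : ℤ → K)) : constraint n s y ≠ 0 := by
  obtain ⟨i, hi, hrow⟩ := exists_row_ne_zero J hy
  obtain ⟨i, rfl⟩ := Nat.exists_eq_add_of_le' (Finset.mem_Icc.mp hi).1
  have his : i < s := by have := (Finset.mem_Icc.mp hi).2; omega
  exact fun h => hrow (congrFun h ⟨i, his⟩)

theorem notMem_range_intCast_of_constraint_eq_zero (hJ : J.card = s) {z : Fin n → K}
    (hz : constraint n s z = 0) (hint : ∀ j ∉ J, z j ∈ Set.range ((↑) : ℤ → K)) {j : Fin n}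
    (hj : j ∈ J) : z j ∉ Set.range ((↑) : ℤ → K) := by
  intro hzj
  refine constraint_ne_zero_of_card_lt ((Finset.card_erase_lt_of_mem hj).trans_eq hJ)
    (fun k hk => ?_) hz
  rcases eq_or_ne k j with rfl | hkj
  · exact hzj
  · exact hint k fun hkJ => hk (Finset.mem_erase.mpr ⟨hkj, hkJ⟩)

end LinearSystem

section Chebyshev

open Polynomial.Chebyshev

theorem T_sq_add_one_sub_X_sq_mul_U_sq (R : Type*) [CommRing R] (m : ℤ) :
    T R (m + 1) ^ 2 + (1 - Polynomial.X ^ 2) * U R m ^ 2 = 1 := by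
  have hU := congrArg (Polynomial.comp · (2 * Polynomial.X)) (S_sq_add_S_sq R m)
  simp only [Polynomial.sub_comp, Polynomial.add_comp, Polynomial.mul_comp, Polynomial.pow_comp,
    S_comp_two_mul_X, Polynomial.X_comp, Polynomial.one_comp] at hU
  linear_combination hU + (U R (m + 1) - Polynomial.X * U R m + T R (m + 1)) *
    (U_eq_X_mul_U_add_T R m).symm

theorem encard_eval_eq_zero_of_derivative_ne_zero {K : Type*} [Field K] [IsAlgClosed K]
    {p : Polynomial K} (h : ∀ x, p.eval x = 0 → p.derivative.eval x ≠ 0) :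
    {x | p.eval x = 0}.encard = p.natDegree := by
  have hsep : p.Separable := by
    refine (Polynomial.isCoprime_iff_aeval_ne_zero_of_isAlgClosed K K _ _).mpr fun x => ?_
    simpa only [Polynomial.coe_aeval_eq_eval, ← imp_iff_not_or] using h x
  have hroots : {x | p.eval x = 0} = p.rootSet K := by
    ext x
    simp [Polynomial.mem_rootSet, hsep.ne_zero]
  rw [hroots, ← Set.coe_fintypeCard, Polynomial.card_rootSet_eq_natDegree hsep
    (IsAlgClosed.splits_domain _)]

variable {K : Type*} [Field K] [CharZero K] {d : ℕ} {x : K}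

theorem eval_T_sq_eq_one_of_eval_derivative_eq_zero (hd : d ≠ 0)
    (h : (T K d).derivative.eval x = 0) : (T K d).eval x ^ 2 = 1 := by
  have hU : (U K ((d : ℤ) - 1)).eval x = 0 := by
    simpa [T_derivative_eq_U, hd] using h
  simpa [hU] using congrArg (Polynomial.eval x) (T_sq_add_one_sub_X_sq_mul_U_sq K ((d : ℤ) - 1))

theorem eval_derivative_derivative_T_ne_zero (hd : d ≠ 0)
    (h : (T K d).derivative.eval x = 0) : (T K d).derivative.derivative.eval x ≠ 0 := by
  intro h2
  have hode := congrArg (Polynomial.eval x)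
    (one_sub_X_sq_mul_derivative_derivative_T_eq_poly_in_T (R := K) d)
  have hT : (T K d).eval x = 0 := by
    simpa [h, h2, hd] using hode
  simpa [hT] using eval_T_sq_eq_one_of_eval_derivative_eq_zero hd h

variable [IsAlgClosed K]

theorem encard_eval_T_eq (hd : d ≠ 0) {c : K} (hc : c ^ 2 ≠ 1) :
    {x | (T K d).eval x = c}.encard = d := by
  have hroots : {x | (T K d).eval x = c} = {x | (T K d - Polynomial.C c).eval x = 0} := by
    simp only [Polynomial.eval_sub, Polynomial.eval_C, sub_eq_zero]
  rw [hroots, encard_eval_eq_zero_of_derivative_ne_zero, Polynomial.natDegree_sub_C,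
    natDegree_T, Int.natAbs_natCast]
  intro x hx hx'
  rw [Polynomial.eval_sub, Polynomial.eval_C, sub_eq_zero] at hx
  rw [Polynomial.derivative_sub, Polynomial.derivative_C, sub_zero] at hx'
  exact hc (hx ▸ eval_T_sq_eq_one_of_eval_derivative_eq_zero hd hx')

theorem encard_eval_derivative_T_eq_zero (hd : d ≠ 0) :
    {x | (T K d).derivative.eval x = 0}.encard = (d - 1 : ℕ) := by
  rw [encard_eval_eq_zero_of_derivative_ne_zero fun x => eval_derivative_derivative_T_ne_zero hd,
    Polynomial.natDegree_derivative, natDegree_T, Int.natAbs_natCast]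

end Chebyshev

section Encard

variable {α β : Type*}

theorem encard_eq_encard_mul_of_encard_fiber_eq {f : α → β} {E : Set α} {F : Set β}
    (hF : F.Finite) (hf : Set.MapsTo f E F) {m : ℕ∞}
    (hm : ∀ b ∈ F, {x | x ∈ E ∧ f x = b}.encard = m) : E.encard = F.encard * m := by
  have hE : E = ⋃ b ∈ F, {x | x ∈ E ∧ f x = b} := by
    ext x
    simpa using fun hx => hf hx
  have hdisj : F.PairwiseDisjoint fun b => {x | x ∈ E ∧ f x = b} := fun b _ c _ hbc =>
    Set.disjoint_left.mpr fun x hb hc => hbc (hb.2.symm.trans hc.2)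
  rw [hE, hF.encard_biUnion hdisj, finsum_mem_congr rfl hm, finsum_mem_eq_finite_toFinset_sum _ hF,
    Finset.sum_const, nsmul_eq_mul, hF.encard_eq_coe_toFinset_card]

theorem encard_forall_mem_and_forall_notMem_eq {ι : Type*} [Finite ι] {A : ι → Set α}
    {J : Finset ι} {m : ℕ∞} (hA : ∀ j ∈ J, (A j).encard = m) (u : ι → α) :
    {x : ι → α | (∀ j ∈ J, x j ∈ A j) ∧ ∀ j ∉ J, x j = u j}.encard = m ^ J.card := by
  classical
  have := Fintype.ofFinite ι
  have hpi : {x : ι → α | (∀ j ∈ J, x j ∈ A j) ∧ ∀ j ∉ J, x j = u j} =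
      Set.univ.pi fun j => if j ∈ J then A j else {u j} := by
    ext x
    simp [Set.pi_if, Set.mem_pi]
  rw [hpi, Set.encard_pi_eq_prod_encard, ← Finset.prod_subset J.subset_univ fun j _ hj => by
    rw [if_neg hj, Set.encard_singleton]]
  exact Finset.prod_eq_pow_card fun j hj => by rw [if_pos hj, hA j hj]

end Encard

section CriticalPoints

open Polynomial.Chebyshev

variable {K : Type*} [Field K] {n d s : ℕ} {x : Fin n → K} {J : Finset (Fin n)}

/-- The variables `z_j = T_d(x_j) + 1` in which the polynomials `f̃_i` are affine. -/
def shiftedChebyshev (d : ℕ) (x : Fin n → K) : Fin n → K :=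
  fun j => (T K d).eval (x j) + 1

open Classical in
/-- The set of indices `j` such that `x_j` is not a critical point of `T_d`. -/
def noncritical (d : ℕ) (x : Fin n → K) : Finset (Fin n) :=
  {j | (T K d).derivative.eval (x j) ≠ 0}

theorem mem_noncritical {j : Fin n} :
    j ∈ noncritical d x ↔ (T K d).derivative.eval (x j) ≠ 0 := by
  simp [noncritical]

/-- The points `x` at which `f̃_1, …, f̃_s` vanish and which admit Lagrange multipliers, that is,
the projection to `𝔸ⁿ` of the common zeros of the `f̃_i` and the `g̃_j`. -/
def criticalPoints (K : Type*) [Field K] (n d s : ℕ) : Set (Fin n → K) :=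
  {x | constraint n s (shiftedChebyshev d x) = 0 ∧
    ∃ v : Fin (s + 1) → K, v ≠ 0 ∧ ∀ j ∈ noncritical d x, multiplierForm n s v j = 0}

theorem mem_criticalPoints_and_noncritical_eq_iff (hJ : J.card = s) :
    x ∈ criticalPoints K n d s ∧ noncritical d x = J ↔
      constraint n s (shiftedChebyshev d x) = 0 ∧ noncritical d x = J :=
  and_congr_left fun h => and_iff_left (h ▸ exists_multiplierForm_eq_zero hJ.le)

theorem add_one_mem_range_intCast_of_sq_eq_one {c : K} (hc : c ^ 2 = 1) :
    c + 1 ∈ Set.range ((↑) : ℤ → K) := by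
  rcases sq_eq_one_iff.mp hc with rfl | rfl
  · exact ⟨2, by norm_num⟩
  · exact ⟨0, by norm_num⟩

variable [CharZero K]

theorem eval_T_add_one_mem_range_intCast (hd : d ≠ 0) {t : K}
    (ht : (T K d).derivative.eval t = 0) : (T K d).eval t + 1 ∈ Set.range ((↑) : ℤ → K) :=
  add_one_mem_range_intCast_of_sq_eq_one (eval_T_sq_eq_one_of_eval_derivative_eq_zero hd ht)

theorem le_card_noncritical (hd : d ≠ 0) (hx : constraint n s (shiftedChebyshev d x) = 0) :
    s ≤ (noncritical d x).card :=
  not_lt.mp fun hlt => constraint_ne_zero_of_card_lt hlt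
    (fun _ hj => eval_T_add_one_mem_range_intCast hd (not_not.mp (mt mem_noncritical.mpr hj))) hx

theorem card_noncritical_le {v : Fin (s + 1) → K} (hv : v ≠ 0)
    (hform : ∀ j ∈ noncritical d x, multiplierForm n s v j = 0) : (noncritical d x).card ≤ s :=
  not_lt.mp fun hlt => hv (eq_zero_of_multiplierForm_eq_zero hlt hform)

theorem card_noncritical_of_mem_criticalPoints (hd : d ≠ 0) (hx : x ∈ criticalPoints K n d s) :
    (noncritical d x).card = s := by
  obtain ⟨hzero, v, hv, hform⟩ := hx
  exact (card_noncritical_le hv hform).antisymm (le_card_noncritical hd hzero)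

theorem constraint_eq_zero_and_noncritical_eq_iff (hd : d ≠ 0) {u z : Fin n → K}
    (hJ : J.card = s) (hu : ∀ j ∉ J, (T K d).derivative.eval (u j) = 0)
    (hxu : ∀ j ∉ J, x j = u j) (hzu : ∀ j ∉ J, z j = shiftedChebyshev d u j)
    (hz : constraint n s z = 0) :
    constraint n s (shiftedChebyshev d x) = 0 ∧ noncritical d x = J ↔
      ∀ j ∈ J, shiftedChebyshev d x j = z j := by
  have hxz : ∀ j ∉ J, shiftedChebyshev d x j = z j := fun j hj => by
    rw [hzu j hj, shiftedChebyshev, shiftedChebyshev, hxu j hj]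
  constructor
  · rintro ⟨hzero, -⟩ j -
    have huniq := (existsUnique_constraint_eq_zero hJ z).unique ⟨hxz, hzero⟩ ⟨fun _ _ => rfl, hz⟩
    rw [huniq]
  · intro hxJ
    have hx : shiftedChebyshev d x = z :=
      funext fun j => if hj : j ∈ J then hxJ j hj else hxz j hj
    refine ⟨hx ▸ hz, Finset.ext fun j => ⟨fun hj => ?_, fun hj => mem_noncritical.mpr fun h => ?_⟩⟩
    · exact not_imp_comm.mp (fun hjJ => by rw [hxu j hjJ, hu j hjJ]) (mem_noncritical.mp hj)
    · refine notMem_range_intCast_of_constraint_eq_zero hJ hz (fun k hk => ?_) hj ?_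
      · exact hzu k hk ▸ eval_T_add_one_mem_range_intCast hd (hu k hk)
      · exact hx ▸ eval_T_add_one_mem_range_intCast hd h

variable [IsAlgClosed K]

theorem encard_constraint_fiber (hd : d ≠ 0) {u : Fin n → K} (hJ : J.card = s)
    (hu : ∀ j ∉ J, (T K d).derivative.eval (u j) = 0) :
    {x | (∀ j ∉ J, x j = u j) ∧
      constraint n s (shiftedChebyshev d x) = 0 ∧ noncritical d x = J}.encard = (d ^ s : ℕ) := by
  obtain ⟨z, ⟨hzu, hz⟩, -⟩ := existsUnique_constraint_eq_zero hJ (shiftedChebyshev d u)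
  have hA : ∀ j ∈ J, {t | (T K d).eval t + 1 = z j}.encard = d := fun j hj => by
    simp only [← eq_sub_iff_add_eq]
    refine encard_eval_T_eq hd fun hsq => ?_
    refine notMem_range_intCast_of_constraint_eq_zero hJ hz (fun k hk => ?_) hj ?_
    · exact hzu k hk ▸ eval_T_add_one_mem_range_intCast hd (hu k hk)
    · simpa using add_one_mem_range_intCast_of_sq_eq_one hsq
  rw [Nat.cast_pow, ← hJ, ← encard_forall_mem_and_forall_notMem_eq hA u, hJ]
  refine congrArg Set.encard (Set.ext fun x => ?_)
  exact (and_congr_right fun hxu =>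
    constraint_eq_zero_and_noncritical_eq_iff hd hJ hu hxu hzu hz).trans and_comm

theorem encard_criticalPoints_noncritical_eq (hd : d ≠ 0) (hJ : J.card = s) :
    {x | x ∈ criticalPoints K n d s ∧ noncritical d x = J}.encard =
      ((d - 1) ^ (n - s) * d ^ s : ℕ) := by
  let U : Set (Fin n → K) :=
    {u | (∀ j ∈ Jᶜ, (T K d).derivative.eval (u j) = 0) ∧ ∀ j ∉ Jᶜ, u j = 0}
  have hU : U.encard = ((d - 1) ^ (n - s) : ℕ) := by
    have hJc : Jᶜ.card = n - s := by rw [Finset.card_compl, Fintype.card_fin, hJ]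
    rw [Nat.cast_pow, ← hJc]
    exact encard_forall_mem_and_forall_notMem_eq
      (fun _ _ => encard_eval_derivative_T_eq_zero hd) 0
  rw [encard_eq_encard_mul_of_encard_fiber_eq (F := U) (f := fun x => J.piecewise 0 x)
    (Set.finite_of_encard_eq_coe hU) (m := (d ^ s : ℕ)), hU, Nat.cast_mul]
  · rintro x ⟨-, hx⟩
    refine ⟨fun j hj => ?_, fun j hj => J.piecewise_eq_of_mem _ _ (by simpa using hj)⟩
    have hjJ : j ∉ J := Finset.mem_compl.mp hj
    simpa [hjJ] using mt mem_noncritical.mpr (hx ▸ hjJ)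
  · rintro u ⟨hu, hu0⟩
    rw [← encard_constraint_fiber hd hJ fun j hj => hu j (Finset.mem_compl.mpr hj)]
    refine congrArg Set.encard (Set.ext fun x => ?_)
    have hfiber : J.piecewise 0 x = u ↔ ∀ j ∉ J, x j = u j := by
      refine funext_iff.trans (forall_congr' fun j => ?_)
      by_cases hj : j ∈ J <;> simp [hj, hu0 j]
    exact (and_congr (mem_criticalPoints_and_noncritical_eq_iff hJ) hfiber).trans and_comm

theorem encard_criticalPoints (hd : d ≠ 0) :
    (criticalPoints K n d s).encard = (n.choose s * d ^ s * (d - 1) ^ (n - s) : ℕ) := by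
  rw [encard_eq_encard_mul_of_encard_fiber_eq
    (F := (Finset.univ.powersetCard s : Finset (Finset (Fin n)))) (f := noncritical d)
    (m := ((d - 1) ^ (n - s) * d ^ s : ℕ)) (Finset.finite_toSet _)]
  · rw [Set.encard_coe_eq_coe_finsetCard, Finset.card_powersetCard, Finset.card_univ,
      Fintype.card_fin, ← Nat.cast_mul, mul_comm ((d - 1) ^ (n - s)), mul_assoc]
  · intro x hx
    exact Finset.mem_coe.mpr <| Finset.mem_powersetCard_univ.mpr <|
      card_noncritical_of_mem_criticalPoints hd hx
  · intro J hJ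
    exact encard_criticalPoints_noncritical_eq hd (Finset.mem_powersetCard_univ.mp hJ)

end CriticalPoints

section Evaluation

variable {R A σ : Type*} [CommSemiring R] [CommSemiring A] [Algebra R A]

theorem aeval_polynomial_aeval_X (z : σ → A) (k : σ) (p : Polynomial R) :
    aeval z (Polynomial.aeval (X k : MvPolynomial σ R) p) = Polynomial.aeval (z k) p := by
  rw [← Polynomial.aeval_algHom_apply, aeval_X]

end Evaluation

section System

open Polynomial.Chebyshev

variable {K : Type*} [Field K] [Algebra ℚ K] {n d s : ℕ}

theorem aeval_derivative_T (t : K) :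
    Polynomial.aeval t (T ℚ d).derivative = (T K d).derivative.eval t := by
  rw [Polynomial.aeval_def, Polynomial.eval₂_eq_eval_map, ← Polynomial.derivative_map, map_T]

theorem aeval_derivative_derivative_T (t : K) :
    Polynomial.aeval t (T ℚ d).derivative.derivative = (T K d).derivative.derivative.eval t := by
  rw [Polynomial.aeval_def, Polynomial.eval₂_eq_eval_map, ← Polynomial.derivative_map,
    ← Polynomial.derivative_map, map_T]

theorem pderiv_sum_chebyshevX (j : Fin n) (b : Fin n → ℚ) :
    pderiv j (∑ k : Fin n, C (b k) * chebyshevX n d k) =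
      C (b j) * Polynomial.aeval (X j) (T ℚ d).derivative := by
  simp [chebyshevX, -aeval_T, Pi.single_apply]

theorem pderiv_gTilde (j : Fin n) :
    pderiv j (gTilde n d) = C (a n 0 (j + 1)) * Polynomial.aeval (X j) (T ℚ d).derivative :=
  pderiv_sum_chebyshevX j fun k => a n 0 (k + 1)

theorem pderiv_fTilde (i : ℕ) (j : Fin n) :
    pderiv j (fTilde n d i) = C (a n i (j + 1)) * Polynomial.aeval (X j) (T ℚ d).derivative := by
  rw [← pderiv_sum_chebyshevX j fun k => a n i (k + 1)]
  simp [fTilde]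

theorem gTildeJ_eq_mul (j : Fin n) :
    gTildeJ n d s j =
      (C (a n 0 (j + 1)) * X (Sum.inr 0) -
        ∑ i : Fin s, C (a n (i + 1) (j + 1)) * X (Sum.inr i.succ)) *
      Polynomial.aeval (X (Sum.inl j)) (T ℚ d).derivative := by
  simp only [gTildeJ, pderiv_gTilde, pderiv_fTilde, map_mul, rename_C, sub_mul, Finset.sum_mul,
    ← Polynomial.aeval_algHom_apply, rename_X]
  congr 1
  · ring
  · exact Finset.sum_congr rfl fun i _ => by ring

theorem dehomogenize_gTildeJ (j : Fin n) :
    dehomogenize (gTildeJ n d s j) =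
      (C (a n 0 (j + 1)) - ∑ i : Fin s, C (a n (i + 1) (j + 1)) * X (Sum.inr i)) *
        Polynomial.aeval (X (Sum.inl j)) (T ℚ d).derivative := by
  simp [gTildeJ_eq_mul, dehomogenize, ← Polynomial.aeval_algHom_apply, algebraMap_eq]

theorem aeval_fTilde (x : Fin n → K) (i : Fin s) :
    aeval x (fTilde n d (i + 1)) = constraint n s (shiftedChebyshev d x) i := by
  simp [fTilde, chebyshevX, -aeval_T, aeval_polynomial_aeval_X, aeval_T (x _), constraint,
    constraintMatrix, shiftedChebyshev, Matrix.mulVec, dotProduct]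

theorem aeval_gTildeJ_eq_mul (x : Fin n → K) (v : Fin (s + 1) → K) (j : Fin n) :
    aeval (Sum.elim x v) (gTildeJ n d s j) =
      multiplierForm n s v j * (T K d).derivative.eval (x j) := by
  simp [gTildeJ_eq_mul, aeval_polynomial_aeval_X, aeval_derivative_T, multiplierForm_apply,
    constraintMatrix, Matrix.vecMul, dotProduct, Fin.tail, mul_comm]

theorem rename_fTilde (i : ℕ) :
    rename (Sum.inl : Fin n → Fin n ⊕ Fin s) (fTilde n d i) =
      C (a n i 0) + ∑ j : Fin n, C (a n i (j + 1)) *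
        (Polynomial.aeval (X (Sum.inl j)) (T ℚ d) + 1) := by
  simp [fTilde, chebyshevX, -aeval_T, ← Polynomial.aeval_algHom_apply]

end System

section Jacobian

open Matrix Polynomial.Chebyshev

theorem det_fromBlocks_diagonal_ne_zero {K ι κ : Type*} [Field K] [Fintype ι] [Fintype κ]
    [DecidableEq ι] [DecidableEq κ] {B : Matrix κ ι K} {g h : ι → K}
    (hgh : ∀ j, h j = 0 ↔ g j ≠ 0)
    (hcol : ∀ c, (∀ j, g j = 0 → c j = 0) → B *ᵥ c = 0 → c = 0)
    (hrow : ∀ l, (∀ j, g j ≠ 0 → (l ᵥ* B) j = 0) → l = 0) :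
    (fromBlocks (diagonal h) (-(diagonal g * Bᵀ)) (B * diagonal g) 0).det ≠ 0 := by
  intro hdet
  obtain ⟨w, hw0, hw⟩ := exists_mulVec_eq_zero_iff.mpr hdet
  obtain ⟨c, l, rfl⟩ : ∃ c l, w = Sum.elim c l := ⟨_, _, (Sum.elim_comp_inl_inr w).symm⟩
  rw [fromBlocks_mulVec, Sum.elim_comp_inl, Sum.elim_comp_inr, ← Sum.elim_zero_zero,
    Sum.elim_eq_iff] at hw
  have htop : ∀ j, h j * c j = g j * (l ᵥ* B) j := fun j => by
    simpa [neg_mulVec, ← mulVec_mulVec, mulVec_diagonal, mulVec_transpose, add_neg_eq_zero]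
      using congrFun hw.1 j
  have hbottom : B *ᵥ (g * c) = 0 := by
    have hgc : g * c = diagonal g *ᵥ c := funext fun j => (mulVec_diagonal g c j).symm
    rw [hgc, mulVec_mulVec]
    simpa using hw.2
  have hl : l = 0 := hrow l fun j hj => by
    simpa [(hgh j).mpr hj, hj] using htop j
  have hgc : g * c = 0 := hcol _ (fun j hj => by simp [hj]) hbottom
  have hc : c = 0 := funext fun j => by
    by_cases hj : g j = 0
    · simpa [hj, mt (hgh j).mp (not_not.mpr hj)] using htop j
    · exact (mul_eq_zero.mp (congrFun hgc j)).resolve_left hj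
  exact hw0 (by rw [hc, hl, Sum.elim_zero_zero])

variable {K : Type*} [Field K] [Algebra ℚ K] {n d s : ℕ}

theorem aeval_jacobianDet (x : Fin n → K) (l : Fin s → K) :
    aeval (Sum.elim x l) (jacobianDet n d s) =
      (fromBlocks
        (diagonal fun j => multiplierForm n s (Fin.cons 1 l : Fin (s + 1) → K) j *
          (T K d).derivative.derivative.eval (x j))
        (-(diagonal (fun j => (T K d).derivative.eval (x j)) * (constraintMatrix K n s)ᵀ))
        (constraintMatrix K n s * diagonal fun j => (T K d).derivative.eval (x j)) 0).det := by
  rw [jacobianDet, AlgHom.map_det]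
  congr 1
  ext (j | i) (k | i')
  · rcases eq_or_ne j k with rfl | hjk
    · simp [affineSystem, dehomogenize_gTildeJ, aeval_polynomial_aeval_X,
        aeval_derivative_derivative_T, multiplierForm_apply, constraintMatrix, vecMul, dotProduct,
        mul_comm]
    · simp [affineSystem, dehomogenize_gTildeJ, hjk]
  · simp [affineSystem, dehomogenize_gTildeJ, Pi.single_apply, aeval_polynomial_aeval_X,
      aeval_derivative_T, constraintMatrix]
  · simp [affineSystem, rename_fTilde, -aeval_T, Pi.single_apply, aeval_polynomial_aeval_X,
      aeval_derivative_T, constraintMatrix]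
  · simp [affineSystem, rename_fTilde, -aeval_T]

theorem aeval_jacobianDet_ne_zero [CharZero K] (hd : d ≠ 0) {x : Fin n → K} {l : Fin s → K}
    (hcard : (noncritical d x).card = s)
    (hform : ∀ j ∈ noncritical d x,
      multiplierForm n s (Fin.cons 1 l : Fin (s + 1) → K) j = 0) :
    aeval (Sum.elim x l) (jacobianDet n d s) ≠ 0 := by
  rw [aeval_jacobianDet]
  refine det_fromBlocks_diagonal_ne_zero (fun j => ⟨fun hj hcrit => ?_, fun hj => ?_⟩)
    (fun c hc => ?_) (fun l hl => ?_)
  · refine mul_ne_zero (fun hform_j => ?_) (eval_derivative_derivative_T_ne_zero hd hcrit) hj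
    have hjJ : j ∉ noncritical d x := fun h => mem_noncritical.mp h hcrit
    have hzero := eq_zero_of_multiplierForm_eq_zero (J := insert j (noncritical d x))
      (by rw [Finset.card_insert_of_notMem hjJ, hcard]; exact s.lt_succ_self)
      ((Finset.forall_mem_insert ..).mpr ⟨hform_j, hform⟩)
    exact one_ne_zero (congrFun hzero 0)
  · rw [hform j (mem_noncritical.mpr hj), zero_mul]
  · exact eq_zero_of_constraintMatrix_mulVec_eq_zero hcard.le
      (fun j hj => hc j (not_not.mp (mt mem_noncritical.mpr hj)))
  · exact eq_zero_of_vecMul_constraintMatrix_eq_zero hcard.ge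
      (fun j hj => hl j (mem_noncritical.mp hj))

end Jacobian

section Variety

variable {n d s : ℕ} {x : Fin n → ℂ} {v : Fin (s + 1) → ℂ}
  {w : (Fin n → ℂ) × Projectivization ℂ (Fin (s + 1) → ℂ)}

theorem mk_mem_startVariety_iff (hv : v ≠ 0) :
    (x, Projectivization.mk ℂ v hv) ∈ startVariety n d s ↔
      constraint n s (shiftedChebyshev d x) = 0 ∧
        ∀ j ∈ noncritical d x, multiplierForm n s v j = 0 := by
  simp only [mk_mem_startVariety, aeval_fTilde, aeval_gTildeJ_eq_mul, mul_eq_zero, mem_noncritical,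
    funext_iff, Pi.zero_apply, or_iff_not_imp_right]

theorem mem_startVariety_iff :
    w ∈ startVariety n d s ↔
      constraint n s (shiftedChebyshev d w.1) = 0 ∧
        ∀ j ∈ noncritical d w.1, multiplierForm n s w.2.rep j = 0 := by
  rw [← mk_mem_startVariety_iff w.2.rep_nonzero, w.2.mk_rep]

theorem fst_image_startVariety : Prod.fst '' startVariety n d s = criticalPoints ℂ n d s := by
  ext x
  constructor
  · rintro ⟨w, hw, rfl⟩
    exact ⟨(mem_startVariety_iff.mp hw).1, w.2.rep, w.2.rep_nonzero, (mem_startVariety_iff.mp hw).2⟩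
  · rintro ⟨hzero, v, hv, hform⟩
    exact ⟨(x, Projectivization.mk ℂ v hv), (mk_mem_startVariety_iff hv).mpr ⟨hzero, hform⟩, rfl⟩

theorem card_noncritical_of_mem_startVariety (hd : d ≠ 0) (hw : w ∈ startVariety n d s) :
    (noncritical d w.1).card = s :=
  card_noncritical_of_mem_criticalPoints hd (fst_image_startVariety ▸ Set.mem_image_of_mem _ hw)

theorem rep_zero_ne_zero_of_mem_startVariety (hd : d ≠ 0) (hw : w ∈ startVariety n d s) :
    w.2.rep 0 ≠ 0 := fun h0 =>
  w.2.rep_nonzero <| eq_zero_of_multiplierForm_eq_zero_of_zero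
    (card_noncritical_of_mem_startVariety hd hw).ge h0 (mem_startVariety_iff.mp hw).2

theorem startVariety_subset_univ_prod_chart (hd : d ≠ 0) :
    startVariety n d s ⊆ Set.univ ×ˢ chart s := fun _ hw =>
  ⟨Set.mem_univ _, rep_zero_ne_zero_of_mem_startVariety hd hw⟩

theorem injOn_fst_startVariety (hd : d ≠ 0) : Set.InjOn Prod.fst (startVariety n d s) := by
  rintro ⟨x, L⟩ hL ⟨_, M⟩ hM rfl
  have hM0 := rep_zero_ne_zero_of_mem_startVariety hd hM
  have hLM : M.rep 0 • L.rep - L.rep 0 • M.rep = 0 := by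
    refine eq_zero_of_multiplierForm_eq_zero_of_zero
      (card_noncritical_of_mem_startVariety hd hL).ge (by simp [mul_comm]) fun j hj => ?_
    rw [map_sub, map_smul, map_smul, Pi.sub_apply, Pi.smul_apply, Pi.smul_apply,
      (mem_startVariety_iff.mp hL).2 j hj, (mem_startVariety_iff.mp hM).2 j hj]
    simp
  refine Prod.ext rfl ?_
  rw [← L.mk_rep, ← M.mk_rep, Projectivization.mk_eq_mk_iff']
  refine ⟨L.rep 0 / M.rep 0, ?_⟩
  rw [div_eq_inv_mul, mul_smul, ← sub_eq_zero.mp hLM, smul_smul, inv_mul_cancel₀ hM0, one_smul]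

theorem encard_startVariety (hd : d ≠ 0) :
    (startVariety n d s).encard = (n.choose s * d ^ s * (d - 1) ^ (n - s) : ℕ) := by
  rw [← (injOn_fst_startVariety hd).encard_image, fst_image_startVariety, encard_criticalPoints hd]

theorem aeval_jacobianDet_ne_zero_of_mem_startVariety (hd : d ≠ 0) (hw : w ∈ startVariety n d s) :
    aeval (Sum.elim w.1 (affineCoord w.2)) (jacobianDet n d s) ≠ 0 := by
  have h0 := rep_zero_ne_zero_of_mem_startVariety hd hw
  have hcons : (Fin.cons 1 (affineCoord w.2) : Fin (s + 1) → ℂ) = (w.2.rep 0)⁻¹ • w.2.rep := by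
    ext i
    refine Fin.cases ?_ (fun i => ?_) i
    · simp [h0]
    · simp [affineCoord, div_eq_inv_mul]
  refine aeval_jacobianDet_ne_zero hd (card_noncritical_of_mem_startVariety hd hw) fun j hj => ?_
  rw [hcons, map_smul, Pi.smul_apply, (mem_startVariety_iff.mp hw).2 j hj, smul_zero]

end Variety

end

end StartSystem

theorem mainTheorem5 (n d s : ℕ) (hs : s ≤ n) (hd : 2 ≤ d) :
    StartSystem.startVariety n d s ⊆ Set.univ ×ˢ StartSystem.chart s ∧
    (StartSystem.startVariety n d s).Finite ∧
    (StartSystem.startVariety n d s).ncard = n.choose s * d ^ s * (d - 1) ^ (n - s) ∧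
    Set.InjOn Prod.fst (StartSystem.startVariety n d s) ∧
    ∀ w ∈ StartSystem.startVariety n d s,
      MvPolynomial.aeval (Sum.elim w.1 (StartSystem.affineCoord w.2))
        (StartSystem.jacobianDet n d s) ≠ 0 := by
  have hd0 : d ≠ 0 := (zero_lt_two.trans_le hd).ne'
  have hcard := StartSystem.encard_startVariety (n := n) (s := s) hd0
  exact ⟨StartSystem.startVariety_subset_univ_prod_chart hd0,
    Set.finite_of_encard_eq_coe hcard,
    congrArg ENat.toNat hcard,
    StartSystem.injOn_fst_startVariety hd0,
    fun _ => StartSystem.aeval_jacobianDet_ne_zero_of_mem_startVariety hd0⟩
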